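/- Let $\mathcal H\neq\{0\}$ be a finite-dimensional complex Hilbert space, let $C_1,\ldots,C_L$ be positive definite operators on $\mathcal H$, and let $q\ge 1$ be real. For an operator $X$ on $\mathcal H$ let $\|X\|_q=(\operatorname{Tr}|X|^q)^{1/q}$ be its Schatten $q$-norm, where $|X|=(X^\dagger X)^{1/2}$; let $C^z=e^{z\log C}$ for positive definite $C$ and $z\in\mathbb C$; and let $\beta_0(t)=\dfrac{\pi}{2[\cosh(\pi t)+1]}$ for $t\in\mathbb R$. Then the function $$t\mapsto \beta_0(t)\,\log\left\|C_1^{(1+it)/q}C_2^{(1+it)/q}\cdots C_L^{(1+it)/q}\right\|_q^q$$ is integrable on $\mathbb R$, and $$\log\operatorname{Tr}\left\{\exp\left\{\log C_1+\cdots+\log C_L\right\}\right\}\le\int_{-\infty}^{\infty}\beta_0(t)\,\log\left\|C_1^{(1+it)/q}C_2^{(1+it)/q}\cdots C_L^{(1+it)/q}\right\|_q^q\,dt .$$ -/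

import Mathlib

noncomputable section

namespace MultiGT

variable {H : Type*} [NormedAddCommGroup H] [InnerProductSpace ℂ H] [FiniteDimensional ℂ H]

/-- The trace of an operator on a finite-dimensional complex Hilbert space. -/
def opTrace (X : H →L[ℂ] H) : ℂ := LinearMap.trace ℂ H (X : H →ₗ[ℂ] H)

/-- The Schatten `p`-norm `‖X‖_p = (Tr |X|^p)^(1/p)`, with `|X| = (X† X)^(1/2)`. The trace of the
positive operator `|X|^p` is a nonnegative real number. -/
def schattenNorm (p : ℝ) (X : H →L[ℂ] H) : ℝ :=
  (opTrace (CFC.rpow (CFC.abs X) p)).re ^ (1 / p)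

/-- The complex power `C^z` of a positive definite operator: the function `x ↦ x^z` applied to
`C` by the functional calculus. -/
def opCpow (C : H →L[ℂ] H) (z : ℂ) : H →L[ℂ] H := cfc (fun x : ℂ => x ^ z) C

/-- The probability density `β₀(t) = π / (2 (cosh (π t) + 1))`. -/
def betaZero (t : ℝ) : ℝ := Real.pi / (2 * (Real.cosh (Real.pi * t) + 1))

/-- The ordered product `C₁^((1+it)/q) ⋯ C_L^((1+it)/q)`. -/
def powerProd {L : ℕ} (C : Fin L → (H →L[ℂ] H)) (q t : ℝ) : H →L[ℂ] H :=
  (List.ofFn fun k => opCpow (C k) ((1 + Complex.I * (t : ℂ)) / (q : ℂ))).prod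

end MultiGT

end

namespace MultiGT

/-! ### Harmonic measure on a vertical strip and Hirschman's lemma. -/

section strip

open Filter Topology Set MeasureTheory

/-! Put `D_k = log C_k`, `S = ∑ D_k`, `c = log Tr e^S` and `ρ = e^(S - c)`, a density operator. The
entire function `F(z) = Tr[ρ^(1 - z/q) e^(z D_1/q) ⋯ e^(z D_L/q)]` (`traceInterpolant`) has `F(0) =
1`. On `Re z = 0` the exponentials are unitary, so `|F| ≤ 1`; at `1 + it` Hölder's inequality
(`norm_sum_mul_inner_le_schattenNorm`) gives `|F| ≤ e^(g t)`, with `g` the logarithm of the Schatten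
norm of the product. To first order the product is `1 + zS/q`, and `S - log ρ = c`, so `F'(0) =
c/q`. The claim is thus `q` times the bound `Re F'(0) ≤ ∫ β₀ g`.

That bound (`re_deriv_le_integral_betaZero`) is Hirschman's sharpening of the three lines theorem,
differentiated at the left edge. Let `Φ` be `stripHolo g`: its real part is 0 on `Re z = 0` and
tends to `g` at `Re z = 1`. Phragmén–Lindelöf gives `|F e^(-Φ)| ≤ 1` in the strip, with value 1 at
0, so the real part has nonpositive right derivative there; and `Φ'(0) = ∫ β₀ g`.

Boundedness and uniform continuity of `g` come from compactness: the products and their inverses are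
uniformly bounded on vertical lines (`boundedUnits`). Boundedness and continuity also give
integrability. -/

theorem one_add_sq_div_two_le_cosh (u : ℝ) : 1 + u ^ 2 / 2 ≤ Real.cosh u := by
  have h1 : Real.cosh u = 1 + 2 * Real.sinh (u / 2) ^ 2 := by
    have := Real.cosh_two_mul (u / 2)
    rw [Real.cosh_sq, mul_div_cancel₀ _ two_ne_zero] at this
    linarith
  have h2 : (u / 2) ^ 2 ≤ Real.sinh (u / 2) ^ 2 := by
    refine sq_le_sq.2 ?_
    rw [Real.abs_sinh]
    exact Real.self_le_sinh_iff.2 (abs_nonneg _)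
  rw [h1]
  nlinarith

/-- Lets every kernel below be dominated by the integrable function `(1 + t²)⁻¹`. -/
theorem one_add_sq_le_cosh_pi_half_mul (t : ℝ) : 1 + t ^ 2 ≤ Real.cosh (Real.pi / 2 * t) := by
  refine le_trans ?_ (one_add_sq_div_two_le_cosh _)
  have h : (9 : ℝ) ≤ Real.pi ^ 2 := by nlinarith [Real.pi_gt_three]
  nlinarith [mul_nonneg (sub_nonneg.2 h) (sq_nonneg t), sq_nonneg t]

theorem one_add_sq_le_cosh_pi_mul (t : ℝ) : 1 + t ^ 2 ≤ Real.cosh (Real.pi * t) := by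
  refine (one_add_sq_le_cosh_pi_half_mul t).trans ?_
  rw [Real.cosh_le_cosh, abs_mul, abs_mul]
  gcongr
  linarith [Real.pi_pos]

/-- The Poisson kernel of the strip `0 < Re z < 1` for its right edge. -/
noncomputable def stripPoisson (x s : ℝ) : ℝ :=
  Real.sin (Real.pi * x) / (2 * (Real.cosh (Real.pi * s) + Real.cos (Real.pi * x)))

theorem continuous_betaZero : Continuous betaZero := by
  unfold betaZero
  refine continuous_const.div (by fun_prop) fun t => ?_
  have := Real.cosh_pos (Real.pi * t)
  positivity

theorem betaZero_nonneg (t : ℝ) : 0 ≤ betaZero t := by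
  have := Real.cosh_pos (Real.pi * t)
  have := Real.pi_pos
  unfold betaZero
  positivity

theorem betaZero_le (t : ℝ) : betaZero t ≤ Real.pi * (1 + t ^ 2)⁻¹ := by
  unfold betaZero
  rw [div_eq_mul_inv]
  have := Real.pi_pos
  gcongr
  nlinarith [one_add_sq_le_cosh_pi_mul t, Real.cosh_pos (Real.pi * t)]

theorem integrable_betaZero_mul {g : ℝ → ℝ} (hg : Continuous g) {M : ℝ} (hM : ∀ t, |g t| ≤ M) :
    Integrable fun t => betaZero t * g t := by
  refine Integrable.mono' ((integrable_inv_one_add_sq.const_mul Real.pi).mul_const M)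
    (continuous_betaZero.mul hg).aestronglyMeasurable (ae_of_all _ fun t => ?_)
  rw [norm_mul, Real.norm_of_nonneg (betaZero_nonneg t)]
  exact mul_le_mul (betaZero_le t) (hM t) (abs_nonneg _)
    ((betaZero_nonneg t).trans (betaZero_le t))

/-! ### The Poisson kernel as an approximate identity. -/

section poisson

variable {x : ℝ}

theorem one_add_cos_pi_mul_pos (hx : x ∈ Ioo (0 : ℝ) 1) : 0 < 1 + Real.cos (Real.pi * x) := by
  have h : Real.cos Real.pi < Real.cos (Real.pi * x) :=
    Real.cos_lt_cos_of_nonneg_of_le_pi (by have := Real.pi_pos; have := hx.1; positivity) le_rfl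
      (by nlinarith [Real.pi_pos, hx.2])
  rw [Real.cos_pi] at h
  linarith

theorem sin_pi_mul_pos (hx : x ∈ Ioo (0 : ℝ) 1) : 0 < Real.sin (Real.pi * x) :=
  Real.sin_pos_of_pos_of_lt_pi (mul_pos Real.pi_pos hx.1) (by nlinarith [Real.pi_pos, hx.2])

theorem stripPoisson_denom_pos (hx : x ∈ Ioo (0 : ℝ) 1) (s : ℝ) :
    0 < Real.cosh (Real.pi * s) + Real.cos (Real.pi * x) := by
  linarith [one_add_cos_pi_mul_pos hx, Real.one_le_cosh (Real.pi * s)]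

theorem stripPoisson_nonneg (hx : x ∈ Ioo (0 : ℝ) 1) (s : ℝ) : 0 ≤ stripPoisson x s :=
  div_nonneg (sin_pi_mul_pos hx).le (mul_pos two_pos (stripPoisson_denom_pos hx s)).le

theorem continuous_stripPoisson (hx : x ∈ Ioo (0 : ℝ) 1) : Continuous (stripPoisson x) := by
  unfold stripPoisson
  exact continuous_const.div (by fun_prop) fun s => (mul_pos two_pos (stripPoisson_denom_pos hx s)).ne'

theorem integrable_stripPoisson (hx : x ∈ Ioo (0 : ℝ) 1) : Integrable (stripPoisson x) := by
  have hc := one_add_cos_pi_mul_pos hx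
  set c := min (1 + Real.cos (Real.pi * x)) 1 with hcdef
  have hc0 : 0 < c := lt_min hc one_pos
  refine Integrable.mono' (integrable_inv_one_add_sq.const_mul c⁻¹)
    (continuous_stripPoisson hx).aestronglyMeasurable (ae_of_all _ fun s => ?_)
  rw [Real.norm_of_nonneg (stripPoisson_nonneg hx s), stripPoisson, ← mul_inv, ← one_div]
  refine div_le_div₀ zero_le_one (Real.sin_le_one _) (by positivity) ?_
  have h1 := one_add_sq_le_cosh_pi_mul s
  have h2 : c ≤ 1 + Real.cos (Real.pi * x) := min_le_left _ _
  have h3 : c ≤ 1 := min_le_right _ _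
  nlinarith [mul_nonneg (sub_nonneg.2 h3) (sq_nonneg s), stripPoisson_denom_pos hx s]

/-- The kernel has an explicit arctangent primitive, whose limits at `∓∞` are `1/2 - x` and `1/2`.
-/
theorem integral_stripPoisson (hx : x ∈ Ioo (0 : ℝ) 1) : ∫ s, stripPoisson x s = x := by
  have hpi := Real.pi_pos
  set a := Real.pi * x with ha
  have hsin : 0 < Real.sin a := sin_pi_mul_pos hx
  have hderiv : ∀ s, HasDerivAt
      (fun s => Real.pi⁻¹ * Real.arctan ((Real.exp (Real.pi * s) + Real.cos a) / Real.sin a))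
      (stripPoisson x s) s := by
    intro s
    have h := (((((hasDerivAt_id s).const_mul Real.pi).exp.add_const (Real.cos a)).div_const
      (Real.sin a)).arctan).const_mul Real.pi⁻¹
    refine h.congr_deriv ?_
    simp only [id, mul_one]
    have hd : Real.cosh (Real.pi * s) + Real.cos a ≠ 0 := (stripPoisson_denom_pos hx s).ne'
    rw [stripPoisson, ← ha]
    rw [Real.cosh_eq, Real.exp_neg] at hd ⊢
    have he := Real.exp_pos (Real.pi * s)
    set E := Real.exp (Real.pi * s)
    have hsc := Real.sin_sq_add_cos_sq a
    set S := Real.sin a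
    set K := Real.cos a
    have h1 : 1 + ((E + K) / S) ^ 2 = E * (2 * ((E + E⁻¹) / 2 + K)) / S ^ 2 := by
      field_simp
      linear_combination hsc
    rw [h1]
    field_simp
  rw [integral_of_hasDerivAt_of_tendsto hderiv (integrable_stripPoisson hx)
    (m := Real.pi⁻¹ * (Real.pi / 2 - a)) (n := Real.pi⁻¹ * (Real.pi / 2))]
  · rw [ha]; field_simp; ring
  · refine Tendsto.const_mul _ ?_
    have h0 : Tendsto (fun s : ℝ => (Real.exp (Real.pi * s) + Real.cos a) / Real.sin a) atBot
        (𝓝 ((0 + Real.cos a) / Real.sin a)) :=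
      ((Real.tendsto_exp_atBot.comp (tendsto_id.const_mul_atBot hpi)).add_const _).div_const _
    have h1 : Real.arctan ((0 + Real.cos a) / Real.sin a) = Real.pi / 2 - a := by
      rw [zero_add, ← Real.sin_pi_div_two_sub, ← Real.cos_pi_div_two_sub a, ← Real.tan_eq_sin_div_cos]
      refine Real.arctan_tan ?_ ?_ <;> nlinarith [hx.1, hx.2]
    rw [← h1]
    exact (Real.continuous_arctan.tendsto _).comp h0
  · refine Tendsto.const_mul _ ?_
    refine (tendsto_nhds_of_tendsto_nhdsWithin Real.tendsto_arctan_atTop).comp ?_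
    exact (tendsto_atTop_add_const_right _ _
      (Real.tendsto_exp_atTop.comp (tendsto_id.const_mul_atTop hpi))).atTop_div_const hsin

/-- Off a neighbourhood of `s = 0` the denominator is at least `s²` whatever `x` is, so the kernel
is `O(sin πx)` and dies as `x → 1`. -/
theorem stripPoisson_le_of_le_abs {δ : ℝ} (hδ : 0 < δ) (hx : x ∈ Ioo (0 : ℝ) 1) {s : ℝ} (hs : δ ≤ |s|) :
    stripPoisson x s ≤ Real.sin (Real.pi * x) * ((1 + δ ^ 2) / δ ^ 2) * (1 + s ^ 2)⁻¹ := by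
  have hs2 : δ ^ 2 ≤ s ^ 2 := by
    rw [← sq_abs s]; gcongr
  rw [stripPoisson, mul_assoc, div_eq_mul_inv]
  have := (sin_pi_mul_pos hx).le
  have hd : (0 : ℝ) < δ ^ 2 := by positivity
  gcongr
  rw [← div_eq_mul_inv, ← one_div, div_le_div_iff₀
    (mul_pos two_pos (stripPoisson_denom_pos hx s)) (by positivity), one_mul, div_mul_eq_mul_div,
    le_div_iff₀ hd]
  have h1 := one_add_sq_le_cosh_pi_mul s
  have h2 := stripPoisson_denom_pos hx s
  have h3 := Real.neg_one_le_cos (Real.pi * x)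
  have h4 : s ^ 2 ≤ 2 * (Real.cosh (Real.pi * s) + Real.cos (Real.pi * x)) := by nlinarith
  calc (1 + s ^ 2) * δ ^ 2 ≤ s ^ 2 * (1 + δ ^ 2) := by nlinarith
    _ ≤ _ := by rw [mul_comm]; gcongr

theorem integrable_stripPoisson_mul (hx : x ∈ Ioo (0 : ℝ) 1) {g : ℝ → ℝ} (hg : Continuous g) {M : ℝ}
    (hM : ∀ t, |g t| ≤ M) (y : ℝ) : Integrable fun s => stripPoisson x s * g (y - s) := by
  refine Integrable.mono' ((integrable_stripPoisson hx).mul_const M)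
    ((continuous_stripPoisson hx).mul (by fun_prop)).aestronglyMeasurable (ae_of_all _ fun s => ?_)
  rw [norm_mul, Real.norm_of_nonneg (stripPoisson_nonneg hx s)]
  exact mul_le_mul_of_nonneg_left (hM _) (stripPoisson_nonneg hx s)

theorem abs_integral_stripPoisson_mul_le (hx : x ∈ Ioo (0 : ℝ) 1) {g : ℝ → ℝ}
    {M : ℝ} (hM : ∀ t, |g t| ≤ M) (y : ℝ) :
    |∫ s, stripPoisson x s * g (y - s)| ≤ M := by
  have hM0 : 0 ≤ M := (abs_nonneg _).trans (hM 0)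
  calc |∫ s, stripPoisson x s * g (y - s)| ≤ ∫ s, stripPoisson x s * M := by
        rw [← Real.norm_eq_abs]
        refine norm_integral_le_of_norm_le ((integrable_stripPoisson hx).mul_const M)
          (ae_of_all _ fun s => ?_)
        rw [norm_mul, Real.norm_of_nonneg (stripPoisson_nonneg hx s)]
        exact mul_le_mul_of_nonneg_left (hM _) (stripPoisson_nonneg hx s)
    _ = x * M := by rw [integral_mul_const, integral_stripPoisson hx]
    _ ≤ M := by nlinarith [hx.2]

/-- Convergence to `g` at the right edge, uniform in `y`. Splitting at `|s| = δ`, continuity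
controls the inside and the factor `sin πx` the outside. -/
theorem abs_integral_stripPoisson_mul_sub_le (hx : x ∈ Ioo (0 : ℝ) 1) {g : ℝ → ℝ} (hg : Continuous g)
    {M δ ε : ℝ} (hM : ∀ t, |g t| ≤ M) (hδ : 0 < δ) (hε : 0 ≤ ε)
    (hgδ : ∀ s t, |s - t| < δ → |g s - g t| ≤ ε) (y : ℝ) :
    |(∫ s, stripPoisson x s * g (y - s)) - x * g y| ≤
      ε + 2 * M * (Real.sin (Real.pi * x) * ((1 + δ ^ 2) / δ ^ 2)) * Real.pi := by
  have hM0 : 0 ≤ M := (abs_nonneg _).trans (hM 0)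
  set K := Real.sin (Real.pi * x) * ((1 + δ ^ 2) / δ ^ 2) with hK
  have hK0 : 0 ≤ K := mul_nonneg (sin_pi_mul_pos hx).le (by positivity)
  have hint := integrable_stripPoisson hx
  have h1 : (∫ s, stripPoisson x s * g (y - s)) - x * g y =
      ∫ s, stripPoisson x s * (g (y - s) - g y) := by
    simp only [mul_sub]
    rw [integral_sub (integrable_stripPoisson_mul hx hg hM y) (hint.mul_const _),
      integral_mul_const, integral_stripPoisson hx]
  rw [h1]
  calc |∫ s, stripPoisson x s * (g (y - s) - g y)|
      ≤ ∫ s, (stripPoisson x s * ε + 2 * M * K * (1 + s ^ 2)⁻¹) := by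
        rw [← Real.norm_eq_abs]
        refine norm_integral_le_of_norm_le
          ((hint.mul_const ε).add (integrable_inv_one_add_sq.const_mul _)) (ae_of_all _ fun s => ?_)
        have hP := stripPoisson_nonneg hx s
        rw [norm_mul, Real.norm_of_nonneg hP, Real.norm_eq_abs]
        rcases lt_or_ge |s| δ with h | h
        · have h2 : |g (y - s) - g y| ≤ ε := hgδ _ _ (by simpa using h)
          have h3 : 0 ≤ 2 * M * K * (1 + s ^ 2)⁻¹ := by positivity
          nlinarith [mul_le_mul_of_nonneg_left h2 hP]
        · have h2 : |g (y - s) - g y| ≤ 2 * M :=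
            (abs_sub _ _).trans (by linarith [hM (y - s), hM y])
          have h3 := stripPoisson_le_of_le_abs hδ hx h
          rw [← hK] at h3
          calc stripPoisson x s * |g (y - s) - g y| ≤ K * (1 + s ^ 2)⁻¹ * (2 * M) := by gcongr
            _ = 2 * M * K * (1 + s ^ 2)⁻¹ := by ring
            _ ≤ _ := le_add_of_nonneg_left (mul_nonneg hP hε)
    _ = x * ε + 2 * M * K * Real.pi := by
        rw [integral_add (hint.mul_const ε) (integrable_inv_one_add_sq.const_mul _),
          integral_mul_const, integral_stripPoisson hx, integral_const_mul,
          integral_univ_inv_one_add_sq]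
    _ ≤ _ := by nlinarith [hx.2]

end poisson

/-! ### The Schwarz kernel and its holomorphic integral. -/

/-- The Schwarz kernel of the strip `|Re z| < 1` normalised to vanish at `z = 0`. -/
noncomputable def stripSchwarz (z : ℂ) (t : ℝ) : ℂ :=
  Complex.tan (Real.pi / 2 * (z - t * Complex.I)) + Complex.tanh (Real.pi / 2 * t) * Complex.I

theorem pi_half_mul_sub (z : ℂ) (t : ℝ) : (Real.pi / 2 * (z - t * Complex.I) : ℂ) =
    (Real.pi / 2 * z.re : ℝ) + (Real.pi / 2 * (z.im - t) : ℝ) * Complex.I := by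
  conv_lhs => rw [← Complex.re_add_im z]
  push_cast
  ring

theorem cos_pi_half_mul_pos {x : ℝ} (hx : |x| < 1) : 0 < Real.cos (Real.pi / 2 * x) := by
  rw [abs_lt] at hx
  refine Real.cos_pos_of_mem_Ioo ⟨?_, ?_⟩ <;> nlinarith [Real.pi_pos, hx.1, hx.2]

/-- The left side is the real part of the cosine. -/
theorem le_norm_cos_pi_half_mul (z : ℂ) (t : ℝ) :
    Real.cos (Real.pi / 2 * z.re) * Real.cosh (Real.pi / 2 * (z.im - t)) ≤
      ‖Complex.cos (Real.pi / 2 * (z - t * Complex.I))‖ := by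
  refine le_trans (le_of_eq ?_) (Complex.re_le_norm _)
  rw [pi_half_mul_sub]
  generalize Real.pi / 2 * z.re = a
  generalize Real.pi / 2 * (z.im - t) = b
  rw [Complex.cos_add_mul_I, ← Complex.ofReal_cos, ← Complex.ofReal_cosh,
    ← Complex.ofReal_sin, ← Complex.ofReal_sinh]
  simp [-Complex.ofReal_cos, -Complex.ofReal_sin, -Complex.ofReal_cosh, -Complex.ofReal_sinh]

theorem cos_pi_half_mul_ne_zero {z : ℂ} (hz : |z.re| < 1) (t : ℝ) :
    Complex.cos (Real.pi / 2 * (z - t * Complex.I)) ≠ 0 :=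
  norm_pos_iff.1 ((mul_pos (cos_pi_half_mul_pos hz) (Real.cosh_pos _)).trans_le
    (le_norm_cos_pi_half_mul z t))

theorem hasDerivAt_stripSchwarz {z : ℂ} (hz : |z.re| < 1) (t : ℝ) :
    HasDerivAt (fun z => stripSchwarz z t)
      (Real.pi / 2 / Complex.cos (Real.pi / 2 * (z - t * Complex.I)) ^ 2) z := by
  unfold stripSchwarz
  have h := (Complex.hasDerivAt_tan (cos_pi_half_mul_ne_zero hz t)).comp z
    (((hasDerivAt_id z).sub_const (t * Complex.I)).const_mul (Real.pi / 2 : ℂ))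
  refine (h.add_const _).congr_deriv ?_
  ring

/-- The two summands do not decay in `t` separately; the addition formula for sine exhibits their
cancellation. -/
theorem stripSchwarz_eq {z : ℂ} (hz : |z.re| < 1) (t : ℝ) : stripSchwarz z t =
    Complex.sin (Real.pi / 2 * z) / (Complex.cos (Real.pi / 2 * (z - t * Complex.I)) *
      Real.cosh (Real.pi / 2 * t)) := by
  have h1 := cos_pi_half_mul_ne_zero hz t
  have h2 : (Real.cosh (Real.pi / 2 * t) : ℂ) ≠ 0 := by
    exact_mod_cast (Real.cosh_pos _).ne'
  have h3 : Complex.sin (Real.pi / 2 * z) = Complex.sin (Real.pi / 2 * (z - t * Complex.I) +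
      (Real.pi / 2 * t : ℝ) * Complex.I) := by
    congr 1; push_cast; ring
  rw [h3, Complex.sin_add, Complex.cos_mul_I, Complex.sin_mul_I, stripSchwarz, Complex.tan,
    Complex.tanh]
  push_cast at h2 ⊢
  generalize (Real.pi / 2 * (z - t * Complex.I) : ℂ) = w at *
  generalize (Real.pi / 2 * t : ℂ) = v at *
  field_simp

theorem continuous_stripSchwarz {z : ℂ} (hz : |z.re| < 1) : Continuous (stripSchwarz z) := by
  rw [funext (stripSchwarz_eq hz)]
  refine continuous_const.div (by fun_prop) fun t => mul_ne_zero (cos_pi_half_mul_ne_zero hz t) ?_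
  exact_mod_cast (Real.cosh_pos _).ne'

theorem norm_stripSchwarz_le {z : ℂ} (hz : |z.re| < 1) (t : ℝ) : ‖stripSchwarz z t‖ ≤
    ‖Complex.sin (Real.pi / 2 * z)‖ / Real.cos (Real.pi / 2 * z.re) * (1 + t ^ 2)⁻¹ := by
  have hc := cos_pi_half_mul_pos hz
  rw [stripSchwarz_eq hz, norm_div, norm_mul, Complex.norm_real,
    Real.norm_of_nonneg (Real.cosh_pos _).le, ← div_eq_mul_inv, div_div]
  gcongr
  · exact (le_mul_of_one_le_right hc.le (Real.one_le_cosh _)).trans (le_norm_cos_pi_half_mul z t)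
  · exact one_add_sq_le_cosh_pi_half_mul t

theorem integrable_stripSchwarz_mul {g : ℝ → ℝ} (hg : Continuous g) {M : ℝ} (hM : ∀ t, |g t| ≤ M)
    {z : ℂ} (hz : |z.re| < 1) : Integrable fun t => stripSchwarz z t * g t := by
  refine Integrable.mono' ((integrable_inv_one_add_sq.const_mul
    (‖Complex.sin (Real.pi / 2 * z)‖ / Real.cos (Real.pi / 2 * z.re))).mul_const M)
    ((continuous_stripSchwarz hz).mul (by fun_prop)).aestronglyMeasurable (ae_of_all _ fun t => ?_)
  rw [norm_mul, Complex.norm_real]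
  exact mul_le_mul (norm_stripSchwarz_le hz t) (hM t) (norm_nonneg _)
    ((norm_nonneg _).trans (norm_stripSchwarz_le hz t))

theorem norm_deriv_stripSchwarz_le {z : ℂ} {c : ℝ} (hc : 0 < c)
    (hzc : c ≤ Real.cos (Real.pi / 2 * z.re)) (t : ℝ) :
    ‖(Real.pi / 2 / Complex.cos (Real.pi / 2 * (z - t * Complex.I)) ^ 2 : ℂ)‖ ≤
      Real.pi / 2 / c ^ 2 * (1 + (z.im - t) ^ 2)⁻¹ := by
  have hpi := Real.pi_pos
  have h1 : c * (1 + (z.im - t) ^ 2) ≤ ‖Complex.cos (Real.pi / 2 * (z - t * Complex.I))‖ :=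
    le_trans (mul_le_mul hzc (one_add_sq_le_cosh_pi_half_mul _) (by positivity) (hc.le.trans hzc))
      (le_norm_cos_pi_half_mul z t)
  have h2 : ‖(Real.pi / 2 : ℂ)‖ = Real.pi / 2 := by
    rw [norm_div, Complex.norm_real, Real.norm_of_nonneg hpi.le]; simp
  have h3 : c ^ 2 * (1 + (z.im - t) ^ 2) ≤
      ‖Complex.cos (Real.pi / 2 * (z - t * Complex.I))‖ ^ 2 := calc
    c ^ 2 * (1 + (z.im - t) ^ 2) ≤ c ^ 2 * (1 + (z.im - t) ^ 2) ^ 2 := by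
        gcongr
        exact le_self_pow₀ (by nlinarith [sq_nonneg (z.im - t)]) two_ne_zero
    _ = (c * (1 + (z.im - t) ^ 2)) ^ 2 := by ring
    _ ≤ _ := by gcongr
  rw [norm_div, norm_pow, h2, ← div_eq_mul_inv, div_div (Real.pi / 2)]
  exact div_le_div_of_nonneg_left (by positivity) (by positivity) h3

theorem hasDerivAt_integral_stripSchwarz {g : ℝ → ℝ} (hg : Continuous g) {M : ℝ}
    (hM : ∀ t, |g t| ≤ M) {z : ℂ} (hz : |z.re| < 1) :
    HasDerivAt (fun z => ∫ t, stripSchwarz z t * g t)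
      (∫ t : ℝ, Real.pi / 2 / Complex.cos (Real.pi / 2 * (z - t * Complex.I)) ^ 2 * g t) z := by
  have hpi := Real.pi_pos
  -- Half the distance to the edges: the ball stays in a smaller closed strip, where the cosine is
  -- at least `c > 0`.
  set r := (1 - |z.re|) / 2 with hr
  have hr0 : 0 < r := by linarith
  have hr1 : r ≤ 1 / 2 := by have := abs_nonneg z.re; linarith
  set c := Real.cos (Real.pi / 2 * (|z.re| + r)) with hcdef
  have hab : |(|z.re| + r)| < 1 := by
    rw [abs_of_nonneg (by positivity)]; linarith
  have hc : 0 < c := cos_pi_half_mul_pos hab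
  have hre : ∀ w ∈ Metric.ball z r, |w.re| ≤ |z.re| + r := by
    intro w hw
    have h1 := (Complex.abs_re_le_norm (w - z)).trans (mem_ball_iff_norm.1 hw).le
    rw [Complex.sub_re] at h1
    have := abs_sub_abs_le_abs_sub w.re z.re
    linarith
  have hre1 : ∀ w ∈ Metric.ball z r, |w.re| < 1 := fun w hw => by
    have := hre w hw
    rw [abs_of_nonneg (by positivity)] at hab
    linarith
  have hwc : ∀ w ∈ Metric.ball z r, c ≤ Real.cos (Real.pi / 2 * w.re) := by
    intro w hw
    rw [← Real.cos_abs (Real.pi / 2 * w.re), abs_mul, abs_of_pos (half_pos hpi)]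
    rw [abs_of_nonneg (by positivity)] at hab
    refine Real.cos_le_cos_of_nonneg_of_le_pi (by positivity) (by nlinarith) ?_
    gcongr
    exact hre w hw
  have hM0 : 0 ≤ M := (abs_nonneg _).trans (hM 0)
  refine (hasDerivAt_integral_of_dominated_loc_of_deriv_le (Metric.ball_mem_nhds z hr0)
    (F := fun z t => stripSchwarz z t * g t)
    (F' := fun z t => Real.pi / 2 / Complex.cos (Real.pi / 2 * (z - t * Complex.I)) ^ 2 * g t)
    -- The factor 3 pays for recentring from `w.im` to `z.im`, which differ by less than 1.
    (bound := fun t => Real.pi / 2 / c ^ 2 * (3 * (1 + (t - z.im) ^ 2)⁻¹) * M)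
    ?_ (integrable_stripSchwarz_mul hg hM hz) ?_ ?_ ?_ ?_).2
  · filter_upwards [Metric.ball_mem_nhds z hr0] with w hw
    exact (integrable_stripSchwarz_mul hg hM (hre1 w hw)).aestronglyMeasurable
  · refine Continuous.aestronglyMeasurable (Continuous.mul (continuous_const.div (by fun_prop)
      fun t => pow_ne_zero 2 (cos_pi_half_mul_ne_zero hz t)) (by fun_prop))
  · refine ae_of_all _ fun t w hw => ?_
    rw [norm_mul, Complex.norm_real]
    refine mul_le_mul ((norm_deriv_stripSchwarz_le hc (hwc w hw) t).trans ?_) (hM t)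
      (norm_nonneg _) (by positivity)
    gcongr
    rw [← div_eq_mul_inv, ← one_div, div_le_div_iff₀ (by positivity) (by positivity)]
    have h1 := (Complex.abs_im_le_norm (w - z)).trans (mem_ball_iff_norm.1 hw).le
    rw [Complex.sub_im] at h1
    have h2 : (w.im - z.im) ^ 2 ≤ 1 := by
      rw [← sq_abs]
      nlinarith [abs_nonneg (w.im - z.im)]
    nlinarith [sq_nonneg ((w.im - t) + (w.im - z.im))]
  · exact (((integrable_inv_one_add_sq.comp_sub_right z.im).const_mul 3).const_mul _).mul_const M
  · exact ae_of_all _ fun t w hw => (hasDerivAt_stripSchwarz (hre1 w hw) t).mul_const _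

/-- The normalising `tanh` term is purely imaginary, so only the tangent contributes. -/
theorem stripSchwarz_re {z : ℂ} (t : ℝ) : (stripSchwarz z t).re / 2 =
    stripPoisson z.re (z.im - t) := by
  set a := Real.pi / 2 * z.re with ha
  set b := Real.pi / 2 * (z.im - t) with hb
  have h1 : (Complex.tanh (Real.pi / 2 * t) * Complex.I).re = 0 := by
    have : (Real.pi / 2 * t : ℂ) = ((Real.pi / 2 * t : ℝ) : ℂ) := by push_cast; ring
    rw [this, ← Complex.ofReal_tanh, Complex.re_ofReal_mul, Complex.I_re, mul_zero]
  rw [stripSchwarz, Complex.add_re, h1, add_zero, pi_half_mul_sub, ← ha, ← hb, Complex.tan,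
    Complex.sin_add_mul_I, Complex.cos_add_mul_I, ← Complex.ofReal_cos, ← Complex.ofReal_cosh,
    ← Complex.ofReal_sin, ← Complex.ofReal_sinh, Complex.div_re, Complex.normSq_apply]
  simp only [Complex.add_re, Complex.sub_re, Complex.mul_re, Complex.ofReal_re, Complex.ofReal_im,
    Complex.I_re, Complex.I_im, Complex.add_im, Complex.sub_im, Complex.mul_im]
  have e1 : Real.pi * z.re = 2 * a := by rw [ha]; ring
  have e2 : Real.pi * (z.im - t) = 2 * b := by rw [hb]; ring
  rw [stripPoisson, e1, e2, Real.sin_two_mul, Real.cos_two_mul, Real.cosh_two_mul]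
  have hs := Real.sin_sq_add_cos_sq a
  have hh := Real.cosh_sq b
  set S := Real.sin a
  set K := Real.cos a
  set SH := Real.sinh b
  set CH := Real.cosh b
  rw [← add_div, div_div]
  have n1 : S * CH * (K * CH) + K * SH * (-(S * SH)) = S * K := by
    linear_combination (S * K) * hh
  have n2 : K * CH * (K * CH) + -(S * SH) * -(S * SH) = SH ^ 2 + K ^ 2 := by
    linear_combination SH ^ 2 * hs + K ^ 2 * hh
  have n3 : 2 * (CH ^ 2 + SH ^ 2 + (2 * K ^ 2 - 1)) = 2 * ((SH ^ 2 + K ^ 2) * 2) := by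
    linear_combination 2 * hh
  rw [n3, mul_assoc 2 S K, mul_div_mul_left _ _ two_ne_zero, ← n1, ← n2]
  congr 1 <;> ring

/-- The holomorphic function on the strip `|Re z| < 1` whose real part has boundary values
`g` on `Re z = 1` and `0` on `Re z = 0`. -/
noncomputable def stripHolo (g : ℝ → ℝ) (z : ℂ) : ℂ := (∫ t, stripSchwarz z t * g t) / 2

section stripHolo

variable {g : ℝ → ℝ} {M : ℝ}

theorem stripHolo_zero : stripHolo g 0 = 0 := by
  have : ∀ t : ℝ, stripSchwarz 0 t = 0 := fun t => by
    rw [stripSchwarz_eq (by simp)]; simp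
  simp [stripHolo, this]

theorem differentiableAt_stripHolo (hg : Continuous g) (hM : ∀ t, |g t| ≤ M) {z : ℂ}
    (hz : |z.re| < 1) : DifferentiableAt ℂ (stripHolo g) z :=
  ((hasDerivAt_integral_stripSchwarz hg hM hz).div_const 2).differentiableAt

/-- The source of `β₀`: at `z = 0` the halved kernel derivative is `π / (4 cosh²(πt/2))`. The kernel
is holomorphic on both sides of `Re z = 0`, so 0 is an interior point. -/
theorem hasDerivAt_stripHolo_zero (hg : Continuous g) (hM : ∀ t, |g t| ≤ M) :
    HasDerivAt (stripHolo g) ((∫ t, betaZero t * g t : ℝ) : ℂ) 0 := by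
  refine ((hasDerivAt_integral_stripSchwarz hg hM (by simp)).div_const 2).congr_deriv ?_
  rw [← integral_complex_ofReal, ← integral_div]
  congr 1
  ext t
  have h1 : (Real.pi / 2 * (0 - t * Complex.I) : ℂ) = -((Real.pi / 2 * t : ℝ) * Complex.I) := by
    push_cast; ring
  have h2 : Real.cosh (Real.pi * t) + 1 = 2 * Real.cosh (Real.pi / 2 * t) ^ 2 := by
    have : Real.pi * t = 2 * (Real.pi / 2 * t) := by ring
    rw [this, Real.cosh_two_mul, Real.cosh_sq]; ring
  rw [h1, Complex.cos_neg, Complex.cos_mul_I, betaZero, h2, ← Complex.ofReal_cosh]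
  push_cast
  field_simp

theorem stripHolo_re (hg : Continuous g) (hM : ∀ t, |g t| ≤ M) {z : ℂ} (hz : |z.re| < 1) :
    (stripHolo g z).re = ∫ s, stripPoisson z.re s * g (z.im - s) := by
  have h1 : (stripHolo g z).re = (∫ t, stripSchwarz z t * g t).re / 2 := by
    rw [stripHolo]
    exact Complex.div_ofNat_re _ _
  have h2 : (∫ t, stripSchwarz z t * g t).re = ∫ t, (stripSchwarz z t * g t).re :=
    (integral_re (integrable_stripSchwarz_mul hg hM hz)).symm
  rw [h1, h2, ← integral_div,
    ← integral_sub_left_eq_self (fun s => stripPoisson z.re s * g (z.im - s)) volume z.im]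
  congr 1
  ext t
  rw [← stripSchwarz_re t]
  simp
  ring

end stripHolo

/-- Cauchy's estimate on unit discs bounds the derivative, at the price of one unit of width on each
side; then the mean value inequality applies on a convex strip. -/
theorem norm_sub_le_of_bounded_strip {E : Type*} [NormedAddCommGroup E] [NormedSpace ℂ E]
    {f : ℂ → E} (hf : Differentiable ℂ f) {B : ℝ} (hB : ∀ z : ℂ, |z.re| ≤ 2 → ‖f z‖ ≤ B) {z w : ℂ}
    (hz : |z.re| ≤ 1) (hw : |w.re| ≤ 1) : ‖f z - f w‖ ≤ B * ‖z - w‖ := by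
  have hconv : Convex ℝ (Complex.re ⁻¹' Icc (-1) 1) :=
    (convex_Icc (-1 : ℝ) 1).linear_preimage Complex.reLm
  refine hconv.norm_image_sub_le_of_norm_deriv_le (𝕜 := ℂ) (fun x _ => hf x) (fun x hx => ?_)
    (abs_le.1 hw) (abs_le.1 hz)
  have h := Complex.norm_deriv_le_of_forall_mem_sphere_norm_le (c := x) (f := f) one_pos
    hf.diffContOnCl (C := B) (fun v hv => hB v ?_)
  · simpa using h
  · have h1 := (Complex.abs_re_le_norm (v - x)).trans (mem_sphere_iff_norm.1 hv).le
    rw [Complex.sub_re] at h1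
    have h2 := abs_le.2 hx
    have := abs_sub_abs_le_abs_sub v.re x.re
    linarith

/-! ### Hirschman's lemma at the left edge. -/

section Hirschman

variable {F : ℂ → ℂ} {g : ℝ → ℝ} {B M : ℝ}

theorem abs_stripHolo_re_le (hg : Continuous g) (hM : ∀ t, |g t| ≤ M) {z : ℂ}
    (hz : z.re ∈ Ioo (0 : ℝ) 1) : |(stripHolo g z).re| ≤ M := by
  rw [stripHolo_re hg hM (by rw [abs_lt]; exact ⟨by linarith [hz.1], hz.2⟩)]
  exact abs_integral_stripPoisson_mul_le hz hM _

theorem stripHolo_re_of_re_eq_zero (hg : Continuous g) (hM : ∀ t, |g t| ≤ M) {z : ℂ}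
    (hz : z.re = 0) : (stripHolo g z).re = 0 := by
  rw [stripHolo_re hg hM (by simp [hz])]
  simp [stripPoisson, hz]

/-- Phragmén–Lindelöf is applied only up to `Re z = x < 1`, since `stripHolo` is controlled only
inside the strip. The excess over 1 measures how far `F` and `stripHolo` at abscissa `x` are from
their edge data. -/
theorem norm_mul_exp_neg_stripHolo_le (hF : Differentiable ℂ F)
    (hB : ∀ z : ℂ, |z.re| ≤ 2 → ‖F z‖ ≤ B) (hg : Continuous g) (hM : ∀ t, |g t| ≤ M)
    (h0 : ∀ z : ℂ, z.re = 0 → ‖F z‖ ≤ 1)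
    (h1 : ∀ y : ℝ, ‖F (1 + y * Complex.I)‖ ≤ Real.exp (g y)) {δ ε : ℝ} (hδ : 0 < δ) (hε : 0 ≤ ε)
    (hgδ : ∀ s t, |s - t| < δ → |g s - g t| ≤ ε) {x : ℝ} (hx : x ∈ Ioo (0 : ℝ) 1) {z : ℂ}
    (hz0 : 0 ≤ z.re) (hzx : z.re ≤ x) :
    ‖F z * Complex.exp (-stripHolo g z)‖ ≤ (1 + B * (1 - x) * Real.exp M) * Real.exp
      (ε + 2 * M * (Real.sin (Real.pi * x) * ((1 + δ ^ 2) / δ ^ 2)) * Real.pi + (1 - x) * M) := by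
  have hM0 : 0 ≤ M := (abs_nonneg _).trans (hM 0)
  have hB0 : 0 ≤ B := (norm_nonneg _).trans (hB 0 (by simp))
  have hx' : 0 ≤ 1 - x := by linarith [hx.2]
  have hsin := (sin_pi_mul_pos hx).le
  set err := ε + 2 * M * (Real.sin (Real.pi * x) * ((1 + δ ^ 2) / δ ^ 2)) * Real.pi with herr
  have herr0 : 0 ≤ err := by have := Real.pi_pos; positivity
  have hnorm : ∀ z, ‖F z * Complex.exp (-stripHolo g z)‖ =
      ‖F z‖ * Real.exp (-(stripHolo g z).re) := fun z => by
    rw [norm_mul, Complex.norm_exp, Complex.neg_re]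
  have hC1 : 1 ≤ (1 + B * (1 - x) * Real.exp M) * Real.exp (err + (1 - x) * M) := by
    refine one_le_mul_of_one_le_of_one_le ?_ (Real.one_le_exp (by positivity))
    have : 0 ≤ B * (1 - x) * Real.exp M := by positivity
    linarith
  have hcl : closure (Complex.re ⁻¹' Ioo 0 x) ⊆ Complex.re ⁻¹' Icc 0 x :=
    closure_minimal (preimage_mono Ioo_subset_Icc_self) (isClosed_Icc.preimage Complex.continuous_re)
  refine PhragmenLindelof.vertical_strip (a := 0) (b := x)
    (f := fun z => F z * Complex.exp (-stripHolo g z)) (DifferentiableOn.diffContOnCl ?_)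
    -- The function is bounded, so zero growth rates suffice.
    ⟨0, by have := Real.pi_pos; have := hx.1; positivity, 0, ?_⟩ ?_ ?_ hz0 hzx
  · intro w hw
    have hw' := hcl hw
    refine ((hF w).mul (differentiableAt_stripHolo hg hM ?_).neg.cexp).differentiableWithinAt
    rw [abs_of_nonneg hw'.1]
    exact hw'.2.trans_lt hx.2
  · refine Asymptotics.IsBigO.of_bound (B * Real.exp M) ?_
    filter_upwards [mem_inf_of_right (mem_principal_self _)] with w hw
    rw [hnorm]
    simp only [zero_mul, Real.exp_zero, norm_one, mul_one]
    have hw' : w.re ∈ Ioo (0 : ℝ) 1 := ⟨hw.1, hw.2.trans hx.2⟩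
    gcongr
    · exact hB w (by rw [abs_of_pos hw'.1]; linarith [hw'.2])
    · linarith [(abs_le.1 (abs_stripHolo_re_le hg hM hw')).1]
  · intro w hw
    rw [hnorm, stripHolo_re_of_re_eq_zero hg hM hw, neg_zero, Real.exp_zero, mul_one]
    exact (h0 w hw).trans hC1
  · intro w hw
    have hw' : w.re ∈ Ioo (0 : ℝ) 1 := by rwa [hw]
    have hF1 : ‖F w‖ ≤ Real.exp (g w.im) * (1 + B * (1 - x) * Real.exp M) := by
      have hsub := norm_sub_le_of_bounded_strip hF hB (z := w) (w := 1 + w.im * Complex.I)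
        (by rw [abs_of_pos hw'.1]; exact hw'.2.le) (by simp)
      have hd : w - (1 + w.im * Complex.I) = ((x - 1 : ℝ) : ℂ) := by
        conv_lhs => rw [← Complex.re_add_im w]
        rw [hw]
        simp
      rw [hd, Complex.norm_real, Real.norm_eq_abs, abs_sub_comm, abs_of_nonneg hx'] at hsub
      -- Turns the additive error `B (1 - x)` into a multiplicative one.
      have h2 : 1 ≤ Real.exp (g w.im) * Real.exp M := by
        rw [← Real.exp_add]
        exact Real.one_le_exp (by linarith [(abs_le.1 (hM w.im)).1])
      have h3 := norm_sub_norm_le (F w) (F (1 + w.im * Complex.I))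
      have h4 : B * (1 - x) ≤ B * (1 - x) * (Real.exp (g w.im) * Real.exp M) :=
        le_mul_of_one_le_right (by positivity) h2
      linarith [h1 w.im]
    have hΦ : g w.im - err - (1 - x) * M ≤ (stripHolo g w).re := by
      rw [stripHolo_re hg hM (by rw [abs_of_pos hw'.1]; exact hw'.2), hw]
      have h2 := (abs_le.1 (abs_integral_stripPoisson_mul_sub_le hx hg hM hδ hε hgδ w.im)).1
      rw [← herr] at h2
      have h3 : (1 - x) * g w.im ≤ (1 - x) * M :=
        mul_le_mul_of_nonneg_left (abs_le.1 (hM _)).2 hx'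
      linarith
    rw [hnorm]
    calc ‖F w‖ * Real.exp (-(stripHolo g w).re)
        ≤ Real.exp (g w.im) * (1 + B * (1 - x) * Real.exp M) *
          Real.exp (err + (1 - x) * M - g w.im) := by
          gcongr
          linarith
      _ = _ := by
          rw [Real.exp_sub]
          field_simp

/-- Let `x → 1` from the left, then `ε → 0`. -/
theorem norm_mul_exp_neg_stripHolo_le_one (hF : Differentiable ℂ F)
    (hB : ∀ z : ℂ, |z.re| ≤ 2 → ‖F z‖ ≤ B) (hg : UniformContinuous g) (hM : ∀ t, |g t| ≤ M)
    (h0 : ∀ z : ℂ, z.re = 0 → ‖F z‖ ≤ 1)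
    (h1 : ∀ y : ℝ, ‖F (1 + y * Complex.I)‖ ≤ Real.exp (g y)) {z : ℂ}
    (hz0 : 0 < z.re) (hz1 : z.re < 1) :
    ‖F z * Complex.exp (-stripHolo g z)‖ ≤ 1 := by
  have hε : ∀ ε > 0, ‖F z * Complex.exp (-stripHolo g z)‖ ≤ Real.exp ε := by
    intro ε hε
    obtain ⟨δ, hδ, hgδ⟩ := Metric.uniformContinuous_iff.1 hg ε hε
    have hlim : Tendsto (fun x : ℝ => (1 + B * (1 - x) * Real.exp M) * Real.exp
        (ε + 2 * M * (Real.sin (Real.pi * x) * ((1 + δ ^ 2) / δ ^ 2)) * Real.pi + (1 - x) * M))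
        (𝓝[<] 1) (𝓝 (Real.exp ε)) := by
      refine tendsto_nhdsWithin_of_tendsto_nhds ?_
      refine (Continuous.tendsto (by fun_prop) 1).trans (le_of_eq ?_)
      simp
    refine ge_of_tendsto hlim ?_
    filter_upwards [Ioo_mem_nhdsLT hz1] with x hx
    exact norm_mul_exp_neg_stripHolo_le hF hB hg.continuous hM h0 h1 hδ hε.le
      (fun s t hst => (hgδ hst).le) ⟨hz0.trans hx.1, hx.2⟩ hz0.le hx.1.le
  have hlim : Tendsto Real.exp (𝓝[>] 0) (𝓝 1) :=
    tendsto_nhdsWithin_of_tendsto_nhds (Real.exp_zero ▸ Real.continuous_exp.tendsto 0)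
  exact ge_of_tendsto hlim (eventually_mem_nhdsWithin.mono hε)

/-- The derivative form at `0` of Hirschman's strengthening of the three lines theorem. -/
theorem re_deriv_le_integral_betaZero (hF : Differentiable ℂ F)
    (hB : ∀ z : ℂ, |z.re| ≤ 2 → ‖F z‖ ≤ B) (hg : UniformContinuous g) (hM : ∀ t, |g t| ≤ M)
    (h0 : ∀ z : ℂ, z.re = 0 → ‖F z‖ ≤ 1)
    (h1 : ∀ y : ℝ, ‖F (1 + y * Complex.I)‖ ≤ Real.exp (g y)) (hF0 : F 0 = 1) :
    (deriv F 0).re ≤ ∫ t, betaZero t * g t := by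
  have hder : HasDerivAt (fun z => F z * Complex.exp (-stripHolo g z))
      (deriv F 0 - (∫ t, betaZero t * g t : ℝ)) 0 := by
    refine ((hF 0).hasDerivAt.mul
      (hasDerivAt_stripHolo_zero hg.continuous hM).neg.cexp).congr_deriv ?_
    simp [stripHolo_zero, hF0, sub_eq_add_neg]
  have hre := HasDerivAt.real_of_complex (z := 0) (by exact_mod_cast hder)
  have hslope := (hasDerivWithinAt_iff_tendsto_slope' (self_notMem_Ioi)).1
    (hre.hasDerivWithinAt (s := Ioi 0))
  have hle := le_of_tendsto (b := 0) hslope (by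
    filter_upwards [Ioo_mem_nhdsGT one_pos] with x hx
    have := (Complex.re_le_norm _).trans (norm_mul_exp_neg_stripHolo_le_one hF hB hg hM h0 h1
      (z := x) (by simpa using hx.1) (by simpa using hx.2))
    rw [slope_def_field]
    refine div_nonpos_of_nonpos_of_nonneg ?_ (by linarith [hx.1])
    simpa [stripHolo_zero, hF0] using this)
  simpa using hle

end Hirschman

end strip

/-! ### Functional calculus, trace and Schatten norms. -/

section operators

open Filter Topology Set

variable {H : Type*} [NormedAddCommGroup H] [InnerProductSpace ℂ H] [FiniteDimensional ℂ H]

theorem finite_spectrum_op (a : H →L[ℂ] H) : (spectrum ℂ a).Finite := by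
  have h := Module.End.finite_spectrum (K := ℂ) (V := H) (a : H →ₗ[ℂ] H)
  rwa [← AlgEquiv.spectrum_eq (Module.End.toContinuousLinearMap (𝕜 := ℂ) H)] at h

theorem continuousOn_spectrum_op (a : H →L[ℂ] H) (f : ℂ → ℂ) : ContinuousOn f (spectrum ℂ a) :=
  (finite_spectrum_op a).continuousOn f

omit [FiniteDimensional ℂ H] in
theorem injective_of_isUnit {X : H →L[ℂ] H} (hX : IsUnit X) : Function.Injective X := by
  obtain ⟨u, rfl⟩ := hX
  refine Function.LeftInverse.injective (g := ((u⁻¹ : (H →L[ℂ] H)ˣ) : H →L[ℂ] H)) fun v => ?_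
  rw [← mul_apply_eq_comp, Units.inv_mul, one_apply_eq_self]

omit [FiniteDimensional ℂ H] in
theorem mem_spectrum_of_apply_eq_smul {a : H →L[ℂ] H} {μ : ℂ} {v : H} (hv : a v = μ • v)
    (hv0 : v ≠ 0) : μ ∈ spectrum ℂ a := by
  intro h
  refine hv0 (injective_of_isUnit h ?_)
  rw [sub_apply, hv, ContinuousLinearMap.algebraMap_apply, sub_self, map_zero]

omit [FiniteDimensional ℂ H] in
theorem aeval_apply_of_apply_eq_smul {a : H →L[ℂ] H} {μ : ℂ} {v : H} (hv : a v = μ • v)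
    (p : Polynomial ℂ) : Polynomial.aeval a p v = p.eval μ • v := by
  induction p using Polynomial.induction_on with
  | C c => simp [ContinuousLinearMap.algebraMap_apply]
  | add p q hp hq => simp [hp, hq, add_smul]
  | monomial n c h =>
    rw [pow_succ, ← mul_assoc, map_mul, Polynomial.aeval_X, mul_apply_eq_comp, hv,
      map_smul, h, smul_smul]
    simp only [Polynomial.eval_mul, Polynomial.eval_X, Polynomial.eval_C, Polynomial.eval_pow]
    congr 1
    ring

/-- On a finite spectrum any function agrees with its Lagrange interpolant, and for polynomials the
claim is algebra. -/
theorem cfc_apply_of_apply_eq_smul {a : H →L[ℂ] H} (ha : IsStarNormal a) {μ : ℂ} {v : H}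
    (hv : a v = μ • v) (f : ℂ → ℂ) : cfc f a v = f μ • v := by
  rcases eq_or_ne v 0 with rfl | hv0
  · simp
  set p := Lagrange.interpolate (finite_spectrum_op a).toFinset id f with hp
  have hpe : ∀ x ∈ spectrum ℂ a, p.eval x = f x := fun x hx =>
    Lagrange.eval_interpolate_at_node (v := id) f (injOn_id _)
      ((finite_spectrum_op a).mem_toFinset.2 hx)
  have h1 : cfc f a = cfc (fun x => p.eval x) a := cfc_congr fun x hx => (hpe x hx).symm
  rw [h1, cfc_polynomial p a ha, aeval_apply_of_apply_eq_smul hv,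
    hpe μ (mem_spectrum_of_apply_eq_smul hv hv0)]

theorem cfc_real_apply_of_apply_eq_smul {a : H →L[ℂ] H} (ha : IsSelfAdjoint a) {μ : ℝ} {v : H}
    (hv : a v = (μ : ℂ) • v) (f : ℝ → ℝ) : cfc f a v = (f μ : ℂ) • v := by
  rw [cfc_real_eq_complex f ha, cfc_apply_of_apply_eq_smul ha.isStarNormal hv, Complex.ofReal_re]

theorem exp_smul_eq_cfc {a : H →L[ℂ] H} (ha : IsStarNormal a) (z : ℂ) :
    NormedSpace.exp (z • a) = cfc (fun x : ℂ => Complex.exp (z * x)) a := by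
  have h1 : z • a = cfc (fun x : ℂ => z * x) a := (cfc_const_mul_id z a ha).symm
  have h2 : IsStarNormal (z • a) := by rw [h1]; exact cfc_predicate _ a
  rw [← CFC.complex_exp_eq_normedSpace_exp h2, h1,
    ← cfc_comp' Complex.exp (fun x : ℂ => z * x) a (Complex.continuous_exp.continuousOn)
      (by fun_prop) ha]

/-- The bound ignores `Im z`, which is what makes all later estimates uniform along vertical lines.
-/
theorem norm_exp_smul_le {a : H →L[ℂ] H} (ha : IsSelfAdjoint a) (z : ℂ) :
    ‖NormedSpace.exp (z • a)‖ ≤ Real.exp (|z.re| * ‖a‖) := by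
  rw [exp_smul_eq_cfc ha.isStarNormal]
  refine norm_cfc_le (Real.exp_pos _).le fun x hx => ?_
  have hxr : x = x.re := ha.mem_spectrum_eq_re hx
  have hxn : |x.re| ≤ ‖a‖ := by
    rcases subsingleton_or_nontrivial (H →L[ℂ] H) with hs | hs
    · exact absurd hx (by simp [spectrum.of_subsingleton])
    · exact (Complex.abs_re_le_norm x).trans (spectrum.norm_le_norm_of_mem hx)
  have hre : (z * x).re = z.re * x.re := by
    conv_lhs => rw [hxr, Complex.re_mul_ofReal]
  rw [Complex.norm_exp, hre]
  refine Real.exp_le_exp.2 ?_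
  calc z.re * x.re ≤ |z.re * x.re| := le_abs_self _
    _ = |z.re| * |x.re| := abs_mul _ _
    _ ≤ _ := by gcongr

theorem opCpow_eq_exp {C : H →L[ℂ] H} (hC : IsStrictlyPositive C) (z : ℂ) :
    opCpow C z = NormedSpace.exp (z • CFC.log C) := by
  have hsa : IsSelfAdjoint C := hC.isSelfAdjoint
  rw [exp_smul_eq_cfc (IsSelfAdjoint.log (a := C)).isStarNormal, CFC.log,
    cfc_real_eq_complex Real.log hsa,
    ← cfc_comp' (fun x : ℂ => Complex.exp (z * x)) (fun x : ℂ => (Real.log x.re : ℂ)) C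
      (by fun_prop) (continuousOn_spectrum_op C _) hsa.isStarNormal, opCpow]
  refine cfc_congr fun x hx => ?_
  have hxr : x = x.re := hsa.mem_spectrum_eq_re hx
  have hpos : 0 < x.re := by
    refine hC.spectrum_pos (𝕜 := ℝ) ?_
    rw [← hsa.spectrumRestricts.image]
    exact ⟨x, hx, rfl⟩
  have hx0 : x ≠ 0 := by
    rw [hxr]; exact_mod_cast hpos.ne'
  rw [Complex.cpow_def_of_ne_zero hx0, Complex.ofReal_log hpos.le, ← hxr, mul_comm]

theorem exists_eigenbasis {a : H →L[ℂ] H} (ha : IsSelfAdjoint a) :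
    ∃ (b : OrthonormalBasis (Fin (Module.finrank ℂ H)) ℂ H) (μ : Fin (Module.finrank ℂ H) → ℝ),
      ∀ i, a (b i) = (μ i : ℂ) • b i :=
  ⟨ha.isSymmetric.eigenvectorBasis rfl, ha.isSymmetric.eigenvalues rfl,
    ha.isSymmetric.apply_eigenvectorBasis rfl⟩

section trace

variable {ι : Type*} [Fintype ι]

omit [FiniteDimensional ℂ H] in
theorem opTrace_eq_sum_of_apply_eq_smul {a : H →L[ℂ] H} (b : OrthonormalBasis ι ℂ H) {μ : ι → ℂ}
    (h : ∀ i, a (b i) = μ i • b i) : opTrace a = ∑ i, μ i := by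
  rw [opTrace, LinearMap.trace_eq_sum_inner _ b]
  refine Finset.sum_congr rfl fun i _ => ?_
  rw [ContinuousLinearMap.coe_coe, h, inner_smul_right, inner_self_eq_norm_sq_to_K,
    b.norm_eq_one]
  simp

theorem schattenNorm_eq (q : ℝ) {X : H →L[ℂ] H} (b : OrthonormalBasis ι ℂ H)
    {μ : ι → ℝ} (h : ∀ i, CFC.abs X (b i) = (μ i : ℂ) • b i) :
    schattenNorm q X = (∑ i, μ i ^ q) ^ (1 / q) := by
  have h1 : ∀ i, CFC.rpow (CFC.abs X) q (b i) = ((μ i ^ q : ℝ) : ℂ) • b i := fun i => by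
    rw [CFC.rpow_eq_pow, CFC.rpow_eq_cfc_real (CFC.abs_nonneg X)]
    exact cfc_real_apply_of_apply_eq_smul (IsSelfAdjoint.of_nonneg (CFC.abs_nonneg X)) (h i) _
  rw [schattenNorm, opTrace_eq_sum_of_apply_eq_smul b h1, ← Complex.ofReal_sum, Complex.ofReal_re]

end trace

/-- The singular value decomposition of an invertible operator. -/
theorem exists_singular_values {X : H →L[ℂ] H} (hX : IsUnit X) :
    ∃ (e : OrthonormalBasis (Fin (Module.finrank ℂ H)) ℂ H) (s : Fin (Module.finrank ℂ H) → ℝ)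
      (h : Fin (Module.finrank ℂ H) → H), (∀ i, 0 < s i) ∧
      (∀ i, CFC.abs X (e i) = (s i : ℂ) • e i) ∧ Orthonormal ℂ h ∧
      ∀ i, X (e i) = (s i : ℂ) • h i := by
  obtain ⟨e, s, hes⟩ := exists_eigenbasis (IsSelfAdjoint.of_nonneg (CFC.abs_nonneg X))
  have hin : ∀ i j, inner ℂ (X (e i)) (X (e j)) = (s j : ℂ) ^ 2 * inner ℂ (e i) (e j) := by
    intro i j
    have h1 : star X (X (e j)) = (s j : ℂ) ^ 2 • e j := by
      rw [← mul_apply_eq_comp, ← CFC.abs_mul_abs, mul_apply_eq_comp, hes,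
        map_smul, hes, smul_smul, sq]
    rw [← ContinuousLinearMap.adjoint_inner_right, ← ContinuousLinearMap.star_eq_adjoint, h1,
      inner_smul_right]
  have hXinj := injective_of_isUnit hX
  have hs0 : ∀ i, 0 ≤ s i := by
    intro i
    have h1 := (CFC.abs_nonneg X)
    rw [ContinuousLinearMap.nonneg_iff_isPositive] at h1
    have h2 := h1.re_inner_nonneg_right (e i)
    rw [hes, inner_smul_right, inner_self_eq_norm_sq_to_K, e.norm_eq_one] at h2
    simpa using h2
  have hs : ∀ i, 0 < s i := by
    intro i
    refine lt_of_le_of_ne (hs0 i) fun h0 => ?_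
    have h1 := hin i i
    rw [← h0] at h1
    have h2 : X (e i) = 0 := by simpa using h1
    have h3 : e i = 0 := hXinj (by rw [h2, map_zero])
    exact e.orthonormal.ne_zero i h3
  refine ⟨e, s, fun i => (s i : ℂ)⁻¹ • X (e i), hs, hes, ?_, fun i => ?_⟩
  · rw [orthonormal_iff_ite]
    intro i j
    have hj : (s j : ℂ) ≠ 0 := by exact_mod_cast (hs j).ne'
    rw [inner_smul_left, inner_smul_right, hin, orthonormal_iff_ite.1 e.orthonormal]
    split_ifs with hij
    · subst hij
      rw [map_inv₀, Complex.conj_ofReal]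
      field_simp
    · simp
  · rw [smul_smul, mul_inv_cancel₀ (by exact_mod_cast (hs i).ne'), one_smul]

theorem schattenNorm_pos [Nontrivial H] (q : ℝ) {X : H →L[ℂ] H} (hX : IsUnit X) :
    0 < schattenNorm q X := by
  obtain ⟨e, s, h, hs, hes, -, -⟩ := exists_singular_values hX
  rw [schattenNorm_eq q e hes]
  have : Nonempty (Fin (Module.finrank ℂ H)) := Fin.pos_iff_nonempty.1 Module.finrank_pos
  exact Real.rpow_pos_of_pos (Finset.sum_pos (fun i _ => Real.rpow_pos_of_pos (hs i) q)
    Finset.univ_nonempty) _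

theorem continuous_schattenNorm {q : ℝ} (hq : 1 ≤ q) : Continuous (schattenNorm (H := H) q) := by
  have hq0 : 0 < q := by linarith
  have habs : Continuous fun X : H →L[ℂ] H => CFC.abs X :=
    CFC.continuousOn_sqrt.comp_continuous (by fun_prop) fun X => star_mul_self_nonneg X
  have hpow : Continuous fun X : H →L[ℂ] H => CFC.rpow (CFC.abs X) q := by
    have h := (CFC.continuousOn_nnrpow (A := H →L[ℂ] H) ⟨q, hq0.le⟩).comp_continuous habs
      fun X => CFC.abs_nonneg X
    refine h.congr fun X => ?_
    exact CFC.nnrpow_eq_rpow (x := ⟨q, hq0.le⟩) hq0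
  have htr : Continuous fun X : H →L[ℂ] H => opTrace X :=
    LinearMap.continuous_of_finiteDimensional
      ((LinearMap.trace ℂ H).comp (ContinuousLinearMap.coeLM ℂ))
  exact (Complex.continuous_re.comp (htr.comp hpow)).rpow_const fun _ =>
    Or.inr (by positivity)

/-- Hölder's inequality for the trace of `X` against an operator that is diagonal in the basis `f`,
with eigenvalues of modulus `r j ^ (1 - 1 / q)`. -/
theorem norm_sum_mul_inner_le_schattenNorm [Nontrivial H] {ι : Type*} [Fintype ι] {q : ℝ}
    (hq : 1 ≤ q) {X : H →L[ℂ] H} (hX : IsUnit X) (f : OrthonormalBasis ι ℂ H) {y : ι → ℂ}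
    {r : ι → ℝ} (hr : ∀ j, 0 ≤ r j) (hr1 : ∑ j, r j = 1)
    (hy : ∀ j, ‖y j‖ = r j ^ (1 - 1 / q)) :
    ‖∑ j, y j * inner ℂ (f j) (X (f j))‖ ≤ schattenNorm q X := by
  obtain ⟨e, s, h, hs, hes, hh, hXe⟩ := exists_singular_values hX
  have hq0 : 0 < q := by linarith
  have hN := schattenNorm_pos q hX
  set N := schattenNorm q X with hNdef
  have hNq : ∑ i, s i ^ q = N ^ q := by
    rw [hNdef, schattenNorm_eq q e hes, ← Real.rpow_mul
      (Finset.sum_nonneg fun i _ => (Real.rpow_pos_of_pos (hs i) q).le),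
      one_div_mul_cancel hq0.ne', Real.rpow_one]
  -- These weights are doubly substochastic (Parseval and Bessel), so Hölder reduces to Young's
  -- inequality for each pair `(i, j)`, with `s` normalised by `N`.
  set w : Fin (Module.finrank ℂ H) → ι → ℝ :=
    fun i j => ‖inner ℂ (e i) (f j)‖ * ‖inner ℂ (f j) (h i)‖ with hw
  have hw0 : ∀ i j, 0 ≤ w i j := fun i j => by positivity
  have hwle : ∀ i j, w i j ≤ (‖inner ℂ (e i) (f j)‖ ^ 2 + ‖inner ℂ (f j) (h i)‖ ^ 2) / 2 :=
    fun i j => by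
      have := two_mul_le_add_sq ‖inner ℂ (e i) (f j)‖ ‖inner ℂ (f j) (h i)‖
      simp only [hw]
      linarith
  have hwi : ∀ i, ∑ j, w i j ≤ 1 := fun i => by
    refine (Finset.sum_le_sum fun j _ => hwle i j).trans ?_
    rw [← Finset.sum_div, Finset.sum_add_distrib, f.sum_sq_norm_inner_left,
      f.sum_sq_norm_inner_right, e.norm_eq_one, hh.1 i]
    norm_num
  have hwj : ∀ j, ∑ i, w i j ≤ 1 := fun j => by
    refine (Finset.sum_le_sum fun i _ => hwle i j).trans ?_
    have h1 := hh.sum_inner_products_le (f j) (s := Finset.univ)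
    rw [f.norm_eq_one] at h1
    simp_rw [← norm_inner_symm (f j)] at h1
    rw [← Finset.sum_div, Finset.sum_add_distrib, e.sum_sq_norm_inner_right, f.norm_eq_one]
    linarith
  have hyoung : ∀ i j, s i * r j ^ (1 - 1 / q) ≤
      N * (1 / q * (s i ^ q / N ^ q) + (1 - 1 / q) * r j) := by
    intro i j
    have h1 : 1 / q ≤ 1 := by rw [div_le_one hq0]; exact hq
    have h2 := Real.geom_mean_le_arith_mean2_weighted (w₁ := 1 / q) (w₂ := 1 - 1 / q)
      (p₁ := s i ^ q / N ^ q) (p₂ := r j) (by positivity) (by linarith)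
      (div_nonneg (Real.rpow_pos_of_pos (hs i) q).le (Real.rpow_pos_of_pos hN q).le) (hr j)
      (by ring)
    rw [← Real.div_rpow (hs i).le hN.le, ← Real.rpow_mul (div_pos (hs i) hN).le,
      mul_one_div_cancel hq0.ne', Real.rpow_one, Real.div_rpow (hs i).le hN.le] at h2
    calc s i * r j ^ (1 - 1 / q) = N * (s i / N * r j ^ (1 - 1 / q)) := by field_simp
      _ ≤ _ := by gcongr
  have hinner : ∀ j, inner ℂ (f j) (X (f j)) =
      ∑ i, inner ℂ (e i) (f j) * (s i * inner ℂ (f j) (h i)) := by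
    intro j
    conv_lhs => rw [← e.sum_repr' (f j), map_sum, inner_sum]
    refine Finset.sum_congr rfl fun i _ => ?_
    rw [map_smul, hXe, inner_smul_right, inner_smul_right, e.sum_repr']
  have hterm : ∀ j, ‖y j * inner ℂ (f j) (X (f j))‖ ≤
      ∑ i, w i j * (N * (1 / q * (s i ^ q / N ^ q) + (1 - 1 / q) * r j)) := by
    intro j
    rw [norm_mul, hy, hinner]
    have hr0 := Real.rpow_nonneg (hr j) (1 - 1 / q)
    refine (mul_le_mul_of_nonneg_left (norm_sum_le _ _) hr0).trans ?_
    rw [Finset.mul_sum]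
    refine Finset.sum_le_sum fun i _ => ?_
    refine le_trans (le_of_eq ?_) (mul_le_mul_of_nonneg_left (hyoung i j) (hw0 i j))
    rw [norm_mul, norm_mul, Complex.norm_real, Real.norm_of_nonneg (hs i).le]
    simp only [hw]
    ring
  have h1q : 0 ≤ 1 - 1 / q := by
    rw [sub_nonneg, div_le_one hq0]; exact hq
  have hA : ∑ j, ∑ i, w i j * (s i ^ q / N ^ q) ≤ 1 := by
    rw [Finset.sum_comm]
    simp_rw [← Finset.sum_mul]
    calc ∑ i, (∑ j, w i j) * (s i ^ q / N ^ q) ≤ ∑ i, 1 * (s i ^ q / N ^ q) := by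
          refine Finset.sum_le_sum fun i _ => mul_le_mul_of_nonneg_right (hwi i) ?_
          exact div_nonneg (Real.rpow_pos_of_pos (hs i) q).le (Real.rpow_pos_of_pos hN q).le
      _ = 1 := by
          simp_rw [one_mul]
          rw [← Finset.sum_div, hNq, div_self (Real.rpow_pos_of_pos hN q).ne']
  have hB : ∑ j, ∑ i, w i j * r j ≤ 1 := by
    simp_rw [← Finset.sum_mul]
    calc ∑ j, (∑ i, w i j) * r j ≤ ∑ j, 1 * r j :=
          Finset.sum_le_sum fun j _ => mul_le_mul_of_nonneg_right (hwj j) (hr j)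
      _ = 1 := by simp_rw [one_mul, hr1]
  calc ‖∑ j, y j * inner ℂ (f j) (X (f j))‖
      ≤ ∑ j, ∑ i, w i j * (N * (1 / q * (s i ^ q / N ^ q) + (1 - 1 / q) * r j)) :=
        (norm_sum_le _ _).trans (Finset.sum_le_sum fun j _ => hterm j)
    _ = N * (1 / q * (∑ j, ∑ i, w i j * (s i ^ q / N ^ q)) +
        (1 - 1 / q) * ∑ j, ∑ i, w i j * r j) := by
        simp_rw [mul_add, Finset.mul_sum, ← Finset.sum_add_distrib]
        refine Finset.sum_congr rfl fun j _ => Finset.sum_congr rfl fun i _ => ?_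
        ring
    _ ≤ N * (1 / q * 1 + (1 - 1 / q) * 1) := by gcongr
    _ = N := by ring

/-! ### Ordered products of exponentials and their compactness. -/

/-- The ordered product of the exponentials `exp (z D)` for `D` in the list `l`. -/
noncomputable def expProd (l : List (H →L[ℂ] H)) (z : ℂ) : H →L[ℂ] H :=
  (l.map fun D => NormedSpace.exp (z • D)).prod

theorem expProd_cons (D : H →L[ℂ] H) (l : List (H →L[ℂ] H)) (z : ℂ) :
    expProd (D :: l) z = NormedSpace.exp (z • D) * expProd l z := by
  simp [expProd]

theorem expProd_zero (l : List (H →L[ℂ] H)) : expProd l 0 = 1 := by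
  simp [expProd]

theorem differentiable_expProd (l : List (H →L[ℂ] H)) : Differentiable ℂ (expProd l) := by
  induction l with
  | nil => exact differentiable_const _
  | cons D l ih =>
    rw [funext (expProd_cons D l)]
    exact Differentiable.mul (fun z => (hasDerivAt_exp_smul_const D z).differentiableAt) ih

theorem hasDerivAt_expProd_zero (l : List (H →L[ℂ] H)) : HasDerivAt (expProd l) l.sum 0 := by
  induction l with
  | nil => exact hasDerivAt_const _ _
  | cons D l ih =>
    rw [funext (expProd_cons D l)]
    refine ((hasDerivAt_exp_smul_const D (0 : ℂ)).mul ih).congr_deriv ?_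
    simp [expProd_zero]

variable {l : List (H →L[ℂ] H)}

theorem norm_expProd_le_of_abs_re_le (hl : ∀ D ∈ l, IsSelfAdjoint D) {R : ℝ} {z : ℂ}
    (hz : |z.re| ≤ R) : ‖expProd l z‖ ≤ Real.exp (R * (l.map norm).sum) := by
  induction l with
  | nil =>
    rw [List.map_nil, List.sum_nil, mul_zero, Real.exp_zero]
    exact ContinuousLinearMap.norm_id_le
  | cons D l ih =>
    rw [expProd_cons, List.map_cons, List.sum_cons, mul_add, Real.exp_add]
    refine (norm_mul_le _ _).trans (mul_le_mul ?_ (ih fun D hD => hl D (by simp [hD]))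
      (norm_nonneg _) (Real.exp_pos _).le)
    refine (norm_exp_smul_le (hl D (by simp)) z).trans ?_
    gcongr

/-- A uniform bound on the inverse keeps the products away from singular operators, hence the
logarithm of the norm bounded below. -/
theorem exists_expProd_inverse (hl : ∀ D ∈ l, IsSelfAdjoint D) (R : ℝ) :
    ∃ B : ℝ, ∀ z : ℂ, |z.re| ≤ R → ∃ Y : H →L[ℂ] H, expProd l z * Y = 1 ∧ Y * expProd l z = 1 ∧
      ‖Y‖ ≤ B := by
  induction l with
  | nil => exact ⟨‖(1 : H →L[ℂ] H)‖, fun z _ => ⟨1, by simp [expProd], by simp [expProd], le_rfl⟩⟩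
  | cons D l ih =>
    obtain ⟨B, hB⟩ := ih fun D hD => hl D (by simp [hD])
    refine ⟨B * Real.exp (R * ‖D‖), fun z hz => ?_⟩
    obtain ⟨Y, h1, h2, h3⟩ := hB z hz
    have e1 : NormedSpace.exp (z • D) * NormedSpace.exp (-z • D) = 1 := by
      let +nondep : NormedAlgebra ℚ (H →L[ℂ] H) := .restrictScalars ℚ ℂ _
      rw [neg_smul, ← NormedSpace.exp_add_of_commute (Commute.refl _).neg_right, add_neg_cancel,
        NormedSpace.exp_zero]
    have e2 : NormedSpace.exp (-z • D) * NormedSpace.exp (z • D) = 1 := by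
      let +nondep : NormedAlgebra ℚ (H →L[ℂ] H) := .restrictScalars ℚ ℂ _
      rw [neg_smul, ← NormedSpace.exp_add_of_commute (Commute.refl (z • D)).neg_left, neg_add_cancel,
        NormedSpace.exp_zero]
    refine ⟨Y * NormedSpace.exp (-z • D), ?_, ?_, ?_⟩
    · rw [expProd_cons, mul_assoc, ← mul_assoc _ Y, h1, one_mul, e1]
    · rw [expProd_cons, mul_assoc, ← mul_assoc _ _ (expProd l z), e2, one_mul, h2]
    · refine (norm_mul_le _ _).trans (mul_le_mul h3 ?_ (norm_nonneg _)
        ((norm_nonneg _).trans h3))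
      refine (norm_exp_smul_le (hl D (by simp)) (-z)).trans ?_
      rw [Complex.neg_re, abs_neg]
      gcongr

/-- The operators of norm at most `R` that have an inverse of norm at most `R`. -/
def boundedUnits (H : Type*) [NormedAddCommGroup H] [InnerProductSpace ℂ H] (R : ℝ) :
    Set (H →L[ℂ] H) :=
  Prod.fst '' {p : (H →L[ℂ] H) × (H →L[ℂ] H) |
    p ∈ Metric.closedBall 0 R ×ˢ Metric.closedBall 0 R ∧ p.1 * p.2 = 1 ∧ p.2 * p.1 = 1}

/-- Carrying the inverse as a second coordinate makes invertibility a closed condition. -/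
theorem isCompact_boundedUnits (R : ℝ) : IsCompact (boundedUnits H R) := by
  have : ProperSpace (H →L[ℂ] H) := FiniteDimensional.proper ℂ _
  refine IsCompact.image ?_ continuous_fst
  refine ((isCompact_closedBall _ _).prod (isCompact_closedBall _ _)).inter_right ?_
  exact (isClosed_eq (by fun_prop) continuous_const).inter
    (isClosed_eq (by fun_prop) continuous_const)

omit [FiniteDimensional ℂ H] in
theorem isUnit_of_mem_boundedUnits {R : ℝ} {X : H →L[ℂ] H} (hX : X ∈ boundedUnits H R) :
    IsUnit X := by
  obtain ⟨⟨A, B⟩, ⟨-, h1, h2⟩, rfl⟩ := hX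
  exact ⟨⟨A, B, h1, h2⟩, rfl⟩

theorem exists_expProd_mem_boundedUnits (hl : ∀ D ∈ l, IsSelfAdjoint D) (R : ℝ) :
    ∃ K, ∀ z : ℂ, |z.re| ≤ R → expProd l z ∈ boundedUnits H K := by
  obtain ⟨B, hB⟩ := exists_expProd_inverse hl R
  refine ⟨max B (Real.exp (R * (l.map norm).sum)), fun z hz => ?_⟩
  obtain ⟨Y, h1, h2, h3⟩ := hB z hz
  refine ⟨(expProd l z, Y), ⟨⟨?_, ?_⟩, h1, h2⟩, rfl⟩
  · rw [mem_closedBall_zero_iff]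
    exact (norm_expProd_le_of_abs_re_le hl hz).trans (le_max_right _ _)
  · rw [mem_closedBall_zero_iff]
    exact h3.trans (le_max_left _ _)

theorem continuousOn_log_schattenNorm [Nontrivial H] {q : ℝ} (hq : 1 ≤ q) (R : ℝ) :
    ContinuousOn (fun X : H →L[ℂ] H => Real.log (schattenNorm q X)) (boundedUnits H R) :=
  (continuous_schattenNorm hq).continuousOn.log fun _ hX =>
    (schattenNorm_pos q (isUnit_of_mem_boundedUnits hX)).ne'

section edge

variable {q : ℝ}

theorem abs_re_div_le (hq : 1 ≤ q) (z : ℂ) : |(z / (q : ℂ)).re| ≤ |z.re| := by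
  rw [Complex.div_ofReal_re, abs_div]
  exact div_le_self (abs_nonneg _) (hq.trans (le_abs_self q))

/-- A Lipschitz curve inside a compact set, followed by a function continuous on that set. -/
theorem uniformContinuous_log_schattenNorm_expProd [Nontrivial H]
    (hl : ∀ D ∈ l, IsSelfAdjoint D) (hq : 1 ≤ q) :
    UniformContinuous fun t : ℝ =>
      Real.log (schattenNorm q (expProd l ((1 + t * Complex.I) / q))) := by
  obtain ⟨K, hK⟩ := exists_expProd_mem_boundedUnits hl 1
  have hmem : ∀ t : ℝ, expProd l ((1 + t * Complex.I) / q) ∈ boundedUnits H K :=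
    fun t => hK _ ((abs_re_div_le hq _).trans (by simp))
  have hunif : UniformContinuous fun t : ℝ => expProd l ((1 + t * Complex.I) / q) := by
    have hd : Differentiable ℂ fun z : ℂ => expProd l (z / q) :=
      (differentiable_expProd l).comp (differentiable_id.div_const _)
    have hlip : LipschitzWith (Real.exp (2 * (l.map norm).sum)).toNNReal
        fun t : ℝ => expProd l ((1 + t * Complex.I) / q) := by
      refine LipschitzWith.of_dist_le_mul fun s t => ?_
      rw [dist_eq_norm, dist_eq_norm, Real.coe_toNNReal _ (Real.exp_pos _).le]
      refine (norm_sub_le_of_bounded_strip hd (fun z hz => norm_expProd_le_of_abs_re_le hl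
        ((abs_re_div_le hq z).trans hz)) (by simp) (by simp)).trans (le_of_eq ?_)
      rw [add_sub_add_left_eq_sub, ← sub_mul, norm_mul, Complex.norm_I, mul_one,
        ← Complex.ofReal_sub, Complex.norm_real]
    exact hlip.uniformContinuous
  have h := (isCompact_boundedUnits K).uniformContinuousOn_of_continuous
    (continuousOn_log_schattenNorm (H := H) hq K)
  rw [Metric.uniformContinuous_iff]
  intro ε hε
  obtain ⟨δ, hδ, h1⟩ := Metric.uniformContinuousOn_iff.1 h ε hε
  obtain ⟨η, hη, h2⟩ := Metric.uniformContinuous_iff.1 hunif δ hδ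
  exact ⟨η, hη, fun s t hst => h1 _ (hmem _) _ (hmem _) (h2 hst)⟩

theorem exists_abs_log_schattenNorm_expProd_le [Nontrivial H]
    (hl : ∀ D ∈ l, IsSelfAdjoint D) (hq : 1 ≤ q) :
    ∃ M, ∀ t : ℝ, |Real.log (schattenNorm q (expProd l ((1 + t * Complex.I) / q)))| ≤ M := by
  obtain ⟨K, hK⟩ := exists_expProd_mem_boundedUnits hl 1
  obtain ⟨M, hM⟩ := (isCompact_boundedUnits K).exists_bound_of_continuousOn
    (continuousOn_log_schattenNorm (H := H) hq K)
  exact ⟨M, fun t => hM _ (hK _ ((abs_re_div_le hq _).trans (by simp)))⟩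

theorem isUnit_expProd (hl : ∀ D ∈ l, IsSelfAdjoint D) (z : ℂ) : IsUnit (expProd l z) := by
  obtain ⟨K, hK⟩ := exists_expProd_mem_boundedUnits hl |z.re|
  exact isUnit_of_mem_boundedUnits (hK z le_rfl)

end edge

/-! ### The interpolating trace and the inequality. -/

section interpolant

variable {ι : Type*} [Fintype ι]

/-- The trace of `expProd l (z / q)` against the `(1 - z / q)`-th power of the density operator
with eigenbasis `f` and log-eigenvalues `θ`. -/
noncomputable def traceInterpolant (l : List (H →L[ℂ] H)) (f : OrthonormalBasis ι ℂ H) (θ : ι → ℝ)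
    (q : ℝ) (z : ℂ) : ℂ :=
  ∑ j, Complex.exp ((1 - z / q) * θ j) * inner ℂ (f j) (expProd l (z / q) (f j))

variable {l : List (H →L[ℂ] H)} {f : OrthonormalBasis ι ℂ H} {θ : ι → ℝ} {q : ℝ}

omit [FiniteDimensional ℂ H] in
theorem norm_inner_apply_basis_le (f : OrthonormalBasis ι ℂ H) (X : H →L[ℂ] H) (j : ι) :
    ‖inner ℂ (f j) (X (f j))‖ ≤ ‖X‖ := by
  refine (norm_inner_le_norm _ _).trans ?_
  rw [f.norm_eq_one, one_mul]
  exact X.unit_le_opNorm _ (f.norm_eq_one j).le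

theorem norm_exp_one_sub_div_mul (z : ℂ) (a : ℝ) :
    ‖Complex.exp ((1 - z / q) * a)‖ = Real.exp ((1 - z.re / q) * a) := by
  rw [Complex.norm_exp, Complex.re_mul_ofReal, Complex.sub_re, Complex.one_re,
    Complex.div_ofReal_re]

theorem hasDerivAt_inner_expProd {X' : H →L[ℂ] H} {z : ℂ}
    (h : HasDerivAt (fun z : ℂ => expProd l (z / q)) X' z) (j : ι) :
    HasDerivAt (fun z : ℂ => inner ℂ (f j) (expProd l (z / q) (f j)))
      (inner ℂ (f j) (X' (f j))) z :=
  ((innerSL ℂ (f j)).comp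
    (ContinuousLinearMap.apply ℂ H (f j))).hasFDerivAt.comp_hasDerivAt z h

theorem hasDerivAt_exp_one_sub_div_mul (z : ℂ) (a : ℝ) :
    HasDerivAt (fun z : ℂ => Complex.exp ((1 - z / q) * a))
      (Complex.exp ((1 - z / q) * a) * (-(1 / q) * a)) z :=
  ((((hasDerivAt_id z).div_const (q : ℂ)).const_sub 1).mul_const (a : ℂ)).cexp

theorem differentiable_traceInterpolant : Differentiable ℂ (traceInterpolant l f θ q) := by
  unfold traceInterpolant
  refine Differentiable.fun_sum fun j _ => Differentiable.mul
    (fun z => (hasDerivAt_exp_one_sub_div_mul z (θ j)).differentiableAt) fun z => ?_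
  exact (hasDerivAt_inner_expProd (((differentiable_expProd l).comp
    (differentiable_id.div_const (q : ℂ)) z).hasDerivAt) j).differentiableAt

theorem traceInterpolant_zero (hθ : ∑ j, Real.exp (θ j) = 1) : traceInterpolant l f θ q 0 = 1 := by
  have h : ∀ j, inner ℂ (f j) (f j) = (1 : ℂ) := fun j => by
    rw [inner_self_eq_norm_sq_to_K, f.norm_eq_one]; simp
  simp only [traceInterpolant, zero_div, sub_zero, one_mul, expProd_zero,
    one_apply_eq_self, h, mul_one]
  exact_mod_cast hθ

/-- The density contributes `-θ j / q` and the product `η j / q`; they add up to the constant `c /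
q`, averaged with weights of sum 1. -/
theorem deriv_traceInterpolant_zero {η : ι → ℝ} {c : ℝ} (hη : ∀ j, l.sum (f j) = (η j : ℂ) • f j)
    (hηθ : ∀ j, θ j = η j - c) (hθ : ∑ j, Real.exp (θ j) = 1) :
    deriv (traceInterpolant l f θ q) 0 = (c / q : ℝ) := by
  have hd : HasDerivAt (fun z : ℂ => expProd l (z / q)) ((1 / q : ℂ) • l.sum) 0 := by
    have h0 : HasDerivAt (expProd l) l.sum ((0 : ℂ) / q) := by
      rw [zero_div]; exact hasDerivAt_expProd_zero l
    exact HasDerivAt.scomp (0 : ℂ) h0 ((hasDerivAt_id (0 : ℂ)).div_const (q : ℂ))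
  have h := HasDerivAt.fun_sum (u := Finset.univ) fun j _ =>
    (hasDerivAt_exp_one_sub_div_mul (q := q) 0 (θ j)).mul (hasDerivAt_inner_expProd (f := f) hd j)
  refine (h.congr_deriv ?_).deriv
  have h1 : ∀ j, inner ℂ (f j) (f j) = (1 : ℂ) := fun j => by
    rw [inner_self_eq_norm_sq_to_K, f.norm_eq_one]; simp
  simp only [zero_div, sub_zero, one_mul, expProd_zero, one_apply_eq_self, h1, mul_one,
    smul_apply, hη, inner_smul_right]
  have h2 : ∀ j, Complex.exp (θ j) * (-(1 / q) * θ j) + Complex.exp (θ j) * (1 / q * η j) =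
      ((Real.exp (θ j) * (c / q) : ℝ) : ℂ) := fun j => by
    rw [hηθ j]; push_cast; ring
  simp_rw [h2]
  rw [← Complex.ofReal_sum, ← Finset.sum_mul, hθ, one_mul]

theorem exists_norm_traceInterpolant_le (hl : ∀ D ∈ l, IsSelfAdjoint D) (hq : 1 ≤ q) :
    ∃ B, ∀ z : ℂ, |z.re| ≤ 2 → ‖traceInterpolant l f θ q z‖ ≤ B := by
  -- The 3 bounds `|1 - Re z / q|`, as `|Re z| ≤ 2` and `q ≥ 1`.
  refine ⟨∑ j, Real.exp (3 * |θ j|) * Real.exp (2 * (l.map norm).sum), fun z hz => ?_⟩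
  refine (norm_sum_le _ _).trans (Finset.sum_le_sum fun j _ => ?_)
  rw [norm_mul, norm_exp_one_sub_div_mul]
  have h1 := (abs_re_div_le hq z).trans hz
  refine mul_le_mul (Real.exp_le_exp.2 ?_) ((norm_inner_apply_basis_le f _ j).trans
    (norm_expProd_le_of_abs_re_le hl h1)) (norm_nonneg _) (Real.exp_pos _).le
  rw [Complex.div_ofReal_re] at h1
  have h2 : |1 - z.re / q| ≤ 3 := by
    rw [abs_le] at h1 ⊢
    exact ⟨by linarith, by linarith⟩
  calc (1 - z.re / q) * θ j ≤ |(1 - z.re / q) * θ j| := le_abs_self _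
    _ = |1 - z.re / q| * |θ j| := abs_mul _ _
    _ ≤ _ := by gcongr

theorem norm_traceInterpolant_le_one (hl : ∀ D ∈ l, IsSelfAdjoint D)
    (hθ : ∑ j, Real.exp (θ j) = 1) {z : ℂ} (hz : z.re = 0) :
    ‖traceInterpolant l f θ q z‖ ≤ 1 := by
  rw [← hθ]
  refine (norm_sum_le _ _).trans (Finset.sum_le_sum fun j _ => ?_)
  have h1 : ‖expProd l (z / q)‖ ≤ 1 := by
    have := norm_expProd_le_of_abs_re_le hl (R := 0) (z := z / q)
      (by rw [Complex.div_ofReal_re, hz]; simp)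
    simpa using this
  rw [norm_mul, norm_exp_one_sub_div_mul, hz, zero_div, sub_zero, one_mul]
  exact mul_le_of_le_one_right (Real.exp_pos _).le ((norm_inner_apply_basis_le f _ j).trans h1)

theorem norm_traceInterpolant_le_schattenNorm [Nontrivial H] (hl : ∀ D ∈ l, IsSelfAdjoint D)
    (hq : 1 ≤ q) (hθ : ∑ j, Real.exp (θ j) = 1) (t : ℝ) :
    ‖traceInterpolant l f θ q (1 + t * Complex.I)‖ ≤
      schattenNorm q (expProd l ((1 + t * Complex.I) / q)) := by
  refine norm_sum_mul_inner_le_schattenNorm hq (isUnit_expProd hl _) f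
    (fun j => (Real.exp_pos (θ j)).le) hθ fun j => ?_
  rw [norm_exp_one_sub_div_mul, ← Real.exp_mul]
  simp [mul_comm]

end interpolant

/-- The multivariate Golden–Thompson inequality in terms of the logarithms of the operators. -/
theorem log_opTrace_exp_sum_le [Nontrivial H] {l : List (H →L[ℂ] H)}
    (hl : ∀ D ∈ l, IsSelfAdjoint D) {q : ℝ} (hq : 1 ≤ q) :
    Real.log (opTrace (NormedSpace.exp l.sum)).re ≤ q * ∫ t : ℝ, betaZero t *
      Real.log (schattenNorm q (expProd l ((1 + t * Complex.I) / q))) := by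
  have hsum : IsSelfAdjoint l.sum := by
    clear hq
    induction l with
    | nil => exact IsSelfAdjoint.zero _
    | cons D l ih =>
      rw [List.sum_cons]
      exact (hl D (by simp)).add (ih fun D hD => hl D (by simp [hD]))
  obtain ⟨f, η, hη⟩ := exists_eigenbasis hsum
  have hexp : ∀ j, NormedSpace.exp l.sum (f j) = ((Real.exp (η j) : ℝ) : ℂ) • f j := fun j => by
    rw [← CFC.real_exp_eq_normedSpace_exp hsum]
    exact cfc_real_apply_of_apply_eq_smul hsum (hη j) _
  rw [opTrace_eq_sum_of_apply_eq_smul f hexp, ← Complex.ofReal_sum, Complex.ofReal_re]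
  have : Nonempty (Fin (Module.finrank ℂ H)) := Fin.pos_iff_nonempty.1 Module.finrank_pos
  have hZ : 0 < ∑ j, Real.exp (η j) :=
    Finset.sum_pos (fun j _ => Real.exp_pos _) Finset.univ_nonempty
  -- Subtracting `c` from the eigenvalues of the sum normalises its exponential to trace 1.
  set c := Real.log (∑ j, Real.exp (η j)) with hc
  have hθ : ∑ j, Real.exp (η j - c) = 1 := by
    simp_rw [Real.exp_sub]
    rw [← Finset.sum_div, hc, Real.exp_log hZ, div_self hZ.ne']
  obtain ⟨B, hB⟩ := exists_norm_traceInterpolant_le (f := f) (θ := fun j => η j - c) hl hq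
  obtain ⟨M, hM⟩ := exists_abs_log_schattenNorm_expProd_le hl hq
  have h := re_deriv_le_integral_betaZero differentiable_traceInterpolant hB
    (uniformContinuous_log_schattenNorm_expProd hl hq) hM
    (fun z hz => norm_traceInterpolant_le_one hl hθ hz)
    (fun t => by
      rw [Real.exp_log (schattenNorm_pos q (isUnit_expProd hl _))]
      exact norm_traceInterpolant_le_schattenNorm hl hq hθ t)
    (traceInterpolant_zero hθ)
  rw [deriv_traceInterpolant_zero hη (fun _ => rfl) hθ, Complex.ofReal_re,
    div_le_iff₀ (by linarith), mul_comm] at h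
  exact h

theorem powerProd_eq_expProd {L : ℕ} {C : Fin L → (H →L[ℂ] H)}
    (hC : ∀ k, IsStrictlyPositive (C k)) (q t : ℝ) : powerProd C q t =
      expProd (List.ofFn fun k => CFC.log (C k)) ((1 + t * Complex.I) / q) := by
  rw [powerProd, expProd, List.map_ofFn]
  congr 2
  ext1 k
  rw [opCpow_eq_exp (hC k), mul_comm Complex.I, Function.comp_apply]

end operators

end MultiGT

theorem mainTheorem3 {H : Type*} [NormedAddCommGroup H] [InnerProductSpace ℂ H]
    [FiniteDimensional ℂ H] [Nontrivial H] {L : ℕ} (C : Fin L → (H →L[ℂ] H))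
    (hC : ∀ k, IsStrictlyPositive (C k)) (q : ℝ) (hq : 1 ≤ q) :
    MeasureTheory.Integrable (fun t : ℝ =>
        MultiGT.betaZero t *
          Real.log (MultiGT.schattenNorm q (MultiGT.powerProd C q t) ^ q)) ∧
      Real.log (MultiGT.opTrace (NormedSpace.exp (∑ k, CFC.log (C k)))).re ≤
        ∫ t : ℝ, MultiGT.betaZero t *
          Real.log (MultiGT.schattenNorm q (MultiGT.powerProd C q t) ^ q) := by
  set l := List.ofFn fun k => CFC.log (C k) with hl_def
  have hl : ∀ D ∈ l, IsSelfAdjoint D := by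
    intro D hD
    obtain ⟨k, rfl⟩ := List.mem_ofFn.1 hD
    exact IsSelfAdjoint.log
  have hfun : (fun t : ℝ => MultiGT.betaZero t *
      Real.log (MultiGT.schattenNorm q (MultiGT.powerProd C q t) ^ q)) = fun t : ℝ =>
      q * (MultiGT.betaZero t * Real.log (MultiGT.schattenNorm q
        (MultiGT.expProd l ((1 + t * Complex.I) / q)))) := by
    ext t
    rw [MultiGT.powerProd_eq_expProd hC, Real.log_rpow (MultiGT.schattenNorm_pos q
      (MultiGT.isUnit_expProd hl _))]
    ring
  obtain ⟨M, hM⟩ := MultiGT.exists_abs_log_schattenNorm_expProd_le hl hq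
  rw [hfun, MeasureTheory.integral_const_mul, ← List.sum_ofFn]
  exact ⟨(MultiGT.integrable_betaZero_mul
    (MultiGT.uniformContinuous_log_schattenNorm_expProd hl hq).continuous hM).const_mul q,
    MultiGT.log_opTrace_exp_sum_le hl hq⟩
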